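/- Let $G$ be a connected (finite-dimensional, real) Lie group with Lie algebra $\mathfrak g=T_{\mathrm{id}}G$, with its analytic structure, and let $\sigma_1,\dots,\sigma_M:[-1,1]\to G$ be analytic ($C^\omega$) paths with $\sigma_i(0)=\mathrm{id}$, with $\sigma_i(-\tau)=\sigma_i(\tau)^{-1}$ for all $\tau\in[-1,1]$, and with tangents $\hat X_i=\frac{d}{d\tau}\sigma_i(\tau)\big|_{\tau=0}\in\mathfrak g$ at the identity. Let $\mathfrak h\subseteq\mathfrak g$ be the smallest Lie subalgebra containing $\hat X_1,\dots,\hat X_M$. Then every $X\in\mathfrak h$ is the identity tangent of a finite product of the basic paths in which each factor is either run, $\tau\mapsto\sigma_i(\alpha\tau)$, or held at a fixed parameter value, $\sigma_i(s)$. More precisely, for every $X\in\mathfrak h$ there are an integer $R\ge 0$, indices $j_1,\dots,j_R\in\{1,\dots,M\}$, real numbers $\alpha_1,\dots,\alpha_R\in[-1,1]$, and elements $g_1,\dots,g_R\in G$, each of which is a finite (possibly empty) product of values $\sigma_i(s)$ with $1\le i\le M$ and $s\in[-1,1]$, such that the path $$\sigma:[-1,1]\to G,\qquad \sigma(\tau)=\prod_{k=1}^{R}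 g_k\,\sigma_{j_k}(\alpha_k\tau)\,g_k^{-1}$$ satisfies $\sigma(0)=\mathrm{id}$ and $\frac{d}{d\tau}\sigma(\tau)\big|_{\tau=0}=X$. (Each $g_k^{-1}$ is again such a product, since $\sigma_i(s)^{-1}=\sigma_i(-s)$.) -/

import Mathlib

open scoped Manifold ContDiff

/-- The path `γ` (of which only the germ at time `0` matters) passes through the identity of the
Lie group `G` at time `0`, is differentiable there, and has the tangent vector `X` there:
`γ 0 = 1` and `d/dτ γ(τ) |_{τ = 0} = X`. The equality is one of points of the tangent bundle, so it
comprises the equality `γ 0 = 1` of base points. -/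
def HasTangentAtOne {n : ℕ} {G : Type*} [TopologicalSpace G]
    [ChartedSpace (EuclideanSpace ℝ (Fin n)) G] [Group G]
    (γ : ℝ → G) (X : GroupLieAlgebra (𝓡 n) G) : Prop :=
  MDifferentiableAt 𝓘(ℝ, ℝ) (𝓡 n) γ 0 ∧
    tangentMap 𝓘(ℝ, ℝ) (𝓡 n) γ (⟨0, (1 : ℝ)⟩ : TangentBundle 𝓘(ℝ, ℝ) ℝ) =
      (⟨1, X⟩ : TangentBundle (𝓡 n) G)

/-- The set of all finite products `σ_{i₁}(s₁) ⋯ σ_{i_p}(s_p)` of values of the basic paths, with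
`p ≥ 0` and all `s_q ∈ [-1, 1]`. -/
def finiteProducts {M : ℕ} {G : Type*} [Group G] (σ : Fin M → ℝ → G) : Set G :=
  {g | ∃ l : List (Fin M × ℝ), (∀ p ∈ l, p.2 ∈ Set.Icc (-1 : ℝ) 1) ∧
    g = (l.map fun p => σ p.1 p.2).prod}

/-- The path `τ ↦ ∏_{k=1}^R g_k σ_{j_k}(α_k τ) g_k⁻¹`, the factors being multiplied in the order
`k = 1, …, R`. -/
def conjugateProductPath {M R : ℕ} {G : Type*} [Group G] (σ : Fin M → ℝ → G)
    (j : Fin R → Fin M) (α : Fin R → ℝ) (g : Fin R → G) (τ : ℝ) : G :=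
  (List.ofFn fun k => g k * σ (j k) (α k * τ) * (g k)⁻¹).prod

/-! The realizable tangents form a linear subspace `V`: multiplying paths adds tangents, and
rescaling time scales them. `V` is also stable under `Ad h` for every finite product `h`, since
conjugating by `h` only replaces each `g k` by `h * g k`. The bracket `⁅X i, Y⁆` is the derivative
at `s = 0` of `Ad (σ i s) Y`, a curve in `V`, and `V` is closed because it is finite-dimensional;
hence `⁅X i, Y⁆ ∈ V` (`IsRealizable.lie`, resting on `lieBracket_fderiv_mem`). A subspace that
contains the generators and is stable under bracketing with them contains the Lie subalgebra they
span (`LieSubalgebra.lieSpan_le_of_lie_mem`). `Ad` never appears explicitly: in the chart at `1`,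
`w' = Ad g w` is expressed as `dR_g w' = dL_g w`. -/

open Filter Topology

/-! ### The bracket as a limit, for a local multiplication on a vector space -/

/-- If `dR_x` maps some vector of `V` to `dL_x w` for all `x` on a curve `c` with velocity `v`, where
`m` is a local multiplication with unit `e`, then the bracket of the left-invariant fields through
`v` and `w` lies in `V`. -/
theorem lieBracket_fderiv_mem {E : Type*} [NormedAddCommGroup E] [NormedSpace ℝ E]
    [FiniteDimensional ℝ E] {m : E × E → E} {e : E} (hm : ContDiffAt ℝ 2 m (e, e))
    (hl : ∀ a, fderiv ℝ m (e, e) (a, 0) = a) (hr : ∀ b, fderiv ℝ m (e, e) (0, b) = b)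
    (V : Submodule ℝ E) {c : ℝ → E} {v w : E} (hc : HasDerivAt c v 0) (hc0 : c 0 = e)
    (hw : w ∈ V)
    (hV : ∀ᶠ s in 𝓝 (0 : ℝ), ∃ w' ∈ V, fderiv ℝ m (e, c s) (w', 0) = fderiv ℝ m (c s, e) (0, w)) :
    VectorField.lieBracket ℝ (fun x => fderiv ℝ m (x, e) (0, v))
      (fun x => fderiv ℝ m (x, e) (0, w)) e ∈ V := by
  have hsymm : IsSymmSndFDerivAt ℝ m (e, e) := hm.isSymmSndFDerivAt (by simp)
  have hD : HasFDerivAt (fderiv ℝ m) (fderiv ℝ (fderiv ℝ m) (e, e)) (e, e) :=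
    ((hm.fderiv_right (m := 1) (by norm_num)).differentiableAt (by norm_num)).hasFDerivAt
  set B := fderiv ℝ (fderiv ℝ m) (e, e)
  have hleft (u : E) : HasFDerivAt (fun x : E => fderiv ℝ m (x, e) (0, u))
      ((B.comp (ContinuousLinearMap.inl ℝ E E)).flip (0, u)) e := by
    have h1 : HasFDerivAt (fun x : E => (x, e)) (ContinuousLinearMap.inl ℝ E E) e :=
      hasFDerivAt_prodMk_left e e
    exact (HasFDerivAt.comp (f := fun x : E => (x, e)) e hD h1).clm_apply (hasFDerivAt_const (0, u) e) |>.congr_fderiv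
      (by ext; simp)
  have hleft' : HasDerivAt (fun s => fderiv ℝ m (c s, e) (0, w)) (B (v, 0) (0, w)) 0 := by
    have h := hleft w
    rw [← hc0] at h
    simpa [hc0, Function.comp_def] using h.comp_hasDerivAt 0 hc
  have hD' : HasDerivAt (fun s => fderiv ℝ m (e, c s)) (B (0, v)) 0 := by
    have h1 : HasDerivAt (fun s => (e, c s)) ((0 : E), v) 0 := (hasDerivAt_const 0 e).prodMk hc
    exact HasFDerivAt.comp_hasDerivAt (f := fun s => (e, c s)) (0 : ℝ) (by simpa [hc0] using hD) h1
  have hright' : HasDerivAt (fun s => fderiv ℝ m (e, c s) (w, 0)) (B (0, v) (w, 0)) 0 := by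
    simpa using hD'.clm_apply (hasDerivAt_const 0 (w, (0 : E)))
  have hbr : VectorField.lieBracket ℝ (fun x => fderiv ℝ m (x, e) (0, v))
      (fun x => fderiv ℝ m (x, e) (0, w)) e = B (v, 0) (0, w) - B (0, v) (w, 0) := by
    -- Symmetry of the second derivative turns `B (w, 0) (0, v)` into `B (0, v) (w, 0)`, so the
    -- bracket is the derivative at `0` of `dL_{c s} w - dR_{c s} w`.
    rw [VectorField.lieBracket_eq]
    simp only [(hleft _).fderiv, hr]
    simpa using hsymm.eq (w, 0) (0, v)
  rw [hbr]
  have hf := hleft'.sub hright'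
  set f' := B (v, 0) (0, w) - B (0, v) (w, 0)
  let K : ℝ → E →L[ℝ] E := fun s => (fderiv ℝ m (e, c s)).comp (ContinuousLinearMap.inl ℝ E E)
  have hK0 : K 0 = 1 := by ext a; simp [K, hc0, hl]
  have hK : ContinuousAt K 0 := by
    have := hD'.continuousAt
    fun_prop
  have hKinv : Tendsto (fun s => Ring.inverse (K s)) (𝓝 0) (𝓝 1) := by
    have h := NormedRing.inverse_continuousAt (1 : (E →L[ℝ] E)ˣ)
    rw [Units.val_one, ContinuousAt, Ring.inverse_one] at h
    exact h.comp (hK0 ▸ hK.tendsto)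
  have hunit : ∀ᶠ s in 𝓝 (0 : ℝ), IsUnit (K s) :=
    hK.eventually (Units.isOpen.mem_nhds (by rw [hK0]; exact isUnit_one))
  have hslope := hf.tendsto_slope
  -- `K s` is `dR_{c s}` at `e` and tends to `1`, so applying its inverse leaves the limit
  -- unchanged, while it turns the slopes into `s⁻¹ • (w' - w) ∈ V`.
  have hlim : Tendsto (fun s => Ring.inverse (K s) (slope ((fun s => fderiv ℝ m (c s, e) (0, w)) -
      fun s => fderiv ℝ m (e, c s) (w, 0)) 0 s)) (𝓝[≠] 0) (𝓝 f') := by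
    have hK' := hKinv.mono_left (nhdsWithin_le_nhds (s := {0}ᶜ))
    exact (isBoundedBilinearMap_apply (𝕜 := ℝ) (E := E) (F := E)).continuous.tendsto (1, f')
      |>.comp (hK'.prodMk_nhds hslope)
  refine V.closed_of_finiteDimensional.mem_of_tendsto hlim ?_
  filter_upwards [nhdsWithin_le_nhds hunit, nhdsWithin_le_nhds hV] with s hs ⟨w', hw', h⟩
  have : slope ((fun s => fderiv ℝ m (c s, e) (0, w)) - fun s => fderiv ℝ m (e, c s) (w, 0)) 0 s
      = K s (s⁻¹ • (w' - w)) := by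
    have h2 : fderiv ℝ m (e, c s) (w' - w, 0) =
        fderiv ℝ m (e, c s) (w', 0) - fderiv ℝ m (e, c s) (w, 0) := by
      rw [← map_sub]; simp
    simp [slope, hc0, hl, hr, K, ← h, h2]
  rw [this]
  change (Ring.inverse (K s) * K s) (s⁻¹ • (w' - w)) ∈ V
  rw [Ring.inverse_mul_cancel _ hs]
  exact V.smul_mem _ (V.sub_mem hw' hw)

/-! ### Tangents at the identity and the multiplication in the chart -/

section
variable {n : ℕ} {G : Type*} [TopologicalSpace G]
    [ChartedSpace (EuclideanSpace ℝ (Fin n)) G] [Group G]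

/-- Reduces tangency to calculus in one fixed vector space. Continuity is listed separately because
the chart reading says nothing about `γ` outside the chart's source. -/
theorem hasTangentAtOne_iff {γ : ℝ → G} {X : GroupLieAlgebra (𝓡 n) G} :
    HasTangentAtOne γ X ↔ γ 0 = 1 ∧ ContinuousAt γ 0 ∧
      HasDerivAt (fun τ => extChartAt (𝓡 n) (1 : G) (γ τ)) (X : EuclideanSpace ℝ (Fin n)) 0 := by
  have hw (h0 : γ 0 = 1) : writtenInExtChartAt 𝓘(ℝ, ℝ) (𝓡 n) 0 γ
      = fun τ => extChartAt (𝓡 n) (1 : G) (γ τ) := by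
    ext1 τ
    simp only [writtenInExtChartAt, h0, extChartAt_model_space_eq_id]
    rfl
  have hder (h0 : γ 0 = 1) (hd : MDifferentiableAt 𝓘(ℝ, ℝ) (𝓡 n) γ 0) :
      (mfderiv 𝓘(ℝ, ℝ) (𝓡 n) γ 0 : ℝ →L[ℝ] EuclideanSpace ℝ (Fin n)) =
        fderiv ℝ (fun τ => extChartAt (𝓡 n) (1 : G) (γ τ)) 0 := by
    refine hd.mfderiv.trans ?_
    rw [hw h0]
    simp only [modelWithCornersSelf_coe, Set.range_id, fderivWithin_univ,
      extChartAt_model_space_eq_id, PartialEquiv.refl_coe, id_eq]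
    rfl
  constructor
  · rintro ⟨hd, ht⟩
    have h0 : γ 0 = 1 := congrArg Bundle.TotalSpace.proj ht
    have ht' : mfderiv 𝓘(ℝ, ℝ) (𝓡 n) γ 0 (1 : ℝ) = X :=
      eq_of_heq ((Bundle.TotalSpace.mk.injEq _ _ _ _).mp ht).2
    refine ⟨h0, hd.continuousAt, ?_⟩
    have h3 := hd.differentiableWithinAt_writtenInExtChartAt
    rw [hw h0] at h3
    simp only [modelWithCornersSelf_coe, Set.range_id, differentiableWithinAt_univ,
      extChartAt_model_space_eq_id, PartialEquiv.refl_coe, id_eq] at h3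
    have h4 := h3.hasFDerivAt.hasDerivAt
    rw [← hder h0 hd] at h4
    exact ht' ▸ h4
  · rintro ⟨h0, hc, hd⟩
    have hm : MDifferentiableAt 𝓘(ℝ, ℝ) (𝓡 n) γ 0 := by
      rw [mdifferentiableAt_iff]
      refine ⟨hc, ?_⟩
      rw [hw h0]
      simp only [modelWithCornersSelf_coe, Set.range_id, differentiableWithinAt_univ,
        extChartAt_model_space_eq_id, PartialEquiv.refl_coe, id_eq]
      exact hd.differentiableAt
    refine ⟨hm, (Bundle.TotalSpace.mk.injEq _ _ _ _).mpr ⟨h0, heq_of_eq ?_⟩⟩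
    have h1 := hder h0 hm
    rw [hd.hasFDerivAt.fderiv] at h1
    exact (congrArg (fun f : ℝ →L[ℝ] EuclideanSpace ℝ (Fin n) => f 1) h1).trans
      (one_smul ℝ (X : EuclideanSpace ℝ (Fin n)))

theorem exists_hasTangentAtOne {γ : ℝ → G} (h0 : γ 0 = 1)
    (h : MDifferentiableAt 𝓘(ℝ, ℝ) (𝓡 n) γ 0) :
    ∃ X : GroupLieAlgebra (𝓡 n) G, HasTangentAtOne γ X :=
  ⟨mfderiv 𝓘(ℝ, ℝ) (𝓡 n) γ 0 (1 : ℝ), h,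
    (Bundle.TotalSpace.mk.injEq _ _ _ _).mpr ⟨h0, HEq.rfl⟩⟩


/-- The multiplication of `G`, read in the preferred chart at the identity. -/
noncomputable def chartMul (n : ℕ) (G : Type*) [TopologicalSpace G]
    [ChartedSpace (EuclideanSpace ℝ (Fin n)) G] [Group G]
    (p : EuclideanSpace ℝ (Fin n) × EuclideanSpace ℝ (Fin n)) : EuclideanSpace ℝ (Fin n) :=
  extChartAt (𝓡 n) (1 : G)
    ((extChartAt (𝓡 n) (1 : G)).symm p.1 * (extChartAt (𝓡 n) (1 : G)).symm p.2)

theorem chartMul_extChartAt {g h : G} (hg : g ∈ (extChartAt (𝓡 n) (1 : G)).source)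
    (hh : h ∈ (extChartAt (𝓡 n) (1 : G)).source) :
    chartMul n G (extChartAt (𝓡 n) (1 : G) g, extChartAt (𝓡 n) (1 : G) h) =
      extChartAt (𝓡 n) (1 : G) (g * h) := by
  simp only [chartMul, PartialEquiv.left_inv _ hg, PartialEquiv.left_inv _ hh]

theorem fderiv_chartMul_left
    (hm : DifferentiableAt ℝ (chartMul n G)
      (extChartAt (𝓡 n) (1 : G) 1, extChartAt (𝓡 n) (1 : G) 1))
    (a : EuclideanSpace ℝ (Fin n)) :
    fderiv ℝ (chartMul n G) (extChartAt (𝓡 n) (1 : G) 1, extChartAt (𝓡 n) (1 : G) 1) (a, 0) =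
      a := by
  set e := extChartAt (𝓡 n) (1 : G) 1 with he
  have h1 : HasFDerivAt (fun x => chartMul n G (x, e)) _ e :=
    HasFDerivAt.comp (f := fun x => (x, e)) e hm.hasFDerivAt (hasFDerivAt_prodMk_left e e)
  have h2 : (fun x => chartMul n G (x, e)) =ᶠ[𝓝 e] id := by
    filter_upwards [extChartAt_target_mem_nhds (I := 𝓡 n) (1 : G)] with x hx
    simp only [chartMul, e, extChartAt_to_inv, mul_one, PartialEquiv.right_inv _ hx, id_eq]
  have := (h1.congr_of_eventuallyEq h2.symm).unique (hasFDerivAt_id e)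
  simpa using congrArg (fun f => f a) this

theorem fderiv_chartMul_right
    (hm : DifferentiableAt ℝ (chartMul n G)
      (extChartAt (𝓡 n) (1 : G) 1, extChartAt (𝓡 n) (1 : G) 1))
    (a : EuclideanSpace ℝ (Fin n)) :
    fderiv ℝ (chartMul n G) (extChartAt (𝓡 n) (1 : G) 1, extChartAt (𝓡 n) (1 : G) 1) (0, a) =
      a := by
  set e := extChartAt (𝓡 n) (1 : G) 1 with he
  have h1 : HasFDerivAt (fun x => chartMul n G (e, x)) _ e :=
    HasFDerivAt.comp (f := fun x => (e, x)) e hm.hasFDerivAt (hasFDerivAt_prodMk_right e e)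
  have h2 : (fun x => chartMul n G (e, x)) =ᶠ[𝓝 e] id := by
    filter_upwards [extChartAt_target_mem_nhds (I := 𝓡 n) (1 : G)] with x hx
    simp only [chartMul, e, extChartAt_to_inv, one_mul, PartialEquiv.right_inv _ hx, id_eq]
  have := (h1.congr_of_eventuallyEq h2.symm).unique (hasFDerivAt_id e)
  simpa using congrArg (fun f => f a) this

theorem fderiv_chartMul
    (hm : DifferentiableAt ℝ (chartMul n G)
      (extChartAt (𝓡 n) (1 : G) 1, extChartAt (𝓡 n) (1 : G) 1))
    (a b : EuclideanSpace ℝ (Fin n)) :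
    fderiv ℝ (chartMul n G) (extChartAt (𝓡 n) (1 : G) 1, extChartAt (𝓡 n) (1 : G) 1) (a, b) =
      a + b := by
  have h : (a, b) = (a, (0 : EuclideanSpace ℝ (Fin n))) + (0, b) := by simp
  rw [h, map_add, fderiv_chartMul_left hm, fderiv_chartMul_right hm]

/-- Read in a chart, the tangents `Z` of `γ` and `Z'` of `g * γ * g⁻¹` are related by
`dR_g Z' = dL_g Z`. -/
theorem fderiv_chartMul_conj {γ : ℝ → G} {Z Z' : GroupLieAlgebra (𝓡 n) G} {g : G}
    (hγ : HasTangentAtOne γ Z) (hγ' : HasTangentAtOne (fun τ => g * γ τ * g⁻¹) Z')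
    (hg : g ∈ (extChartAt (𝓡 n) (1 : G)).source)
    (h1 : DifferentiableAt ℝ (chartMul n G)
      (extChartAt (𝓡 n) (1 : G) 1, extChartAt (𝓡 n) (1 : G) g))
    (h2 : DifferentiableAt ℝ (chartMul n G)
      (extChartAt (𝓡 n) (1 : G) g, extChartAt (𝓡 n) (1 : G) 1)) :
    fderiv ℝ (chartMul n G) (extChartAt (𝓡 n) (1 : G) 1, extChartAt (𝓡 n) (1 : G) g) (Z', 0) =
    fderiv ℝ (chartMul n G) (extChartAt (𝓡 n) (1 : G) g, extChartAt (𝓡 n) (1 : G) 1) (0, Z) := by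
  rw [hasTangentAtOne_iff] at *
  obtain ⟨h0, hc, hd⟩ := hγ
  obtain ⟨h0', hc', hd'⟩ := hγ'
  have e1 := HasFDerivAt.comp_hasDerivAt_of_eq (0 : ℝ) h2.hasFDerivAt
    ((hasDerivAt_const (0 : ℝ) (extChartAt (𝓡 n) (1 : G) g)).prodMk hd) (by rw [h0])
  have e2 := HasFDerivAt.comp_hasDerivAt_of_eq (0 : ℝ) h1.hasFDerivAt
    (hd'.prodMk (hasDerivAt_const (0 : ℝ) (extChartAt (𝓡 n) (1 : G) g))) (by rw [h0'])
  -- Both sides differentiate the same curve, since `(g * γ τ * g⁻¹) * g = g * γ τ`.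
  refine e2.unique (e1.congr_of_eventuallyEq ?_)
  have hs := extChartAt_source_mem_nhds (I := 𝓡 n) (1 : G)
  filter_upwards [hc.eventually_mem (by rwa [h0]), hc'.eventually_mem (by rwa [h0'])] with τ h3 h4
  simp only [Function.comp_apply]
  rw [chartMul_extChartAt h4 hg, chartMul_extChartAt hg h3]
  simp

variable [LieGroup (𝓡 n) ω G]

theorem contDiffAt_chartMul : ContDiffAt ℝ ω (chartMul n G)
    (extChartAt (𝓡 n) (1 : G) 1, extChartAt (𝓡 n) (1 : G) 1) := by
  rw [← contMDiffAt_iff_contDiffAt]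
  have hs : ContMDiffAt 𝓘(ℝ, EuclideanSpace ℝ (Fin n)) (𝓡 n) ω (extChartAt (𝓡 n) (1 : G)).symm
      (extChartAt (𝓡 n) (1 : G) 1) :=
    (contMDiffOn_extChartAt_symm (1 : G)).contMDiffAt (extChartAt_target_mem_nhds (1 : G))
  set e := extChartAt (𝓡 n) (1 : G) 1 with he
  have h1 : ContMDiffAt 𝓘(ℝ, EuclideanSpace ℝ (Fin n) × EuclideanSpace ℝ (Fin n)) (𝓡 n) ω
      (fun p => (extChartAt (𝓡 n) (1 : G)).symm p.1) (e, e) :=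
    ContMDiffAt.comp (e, e) hs contDiff_fst.contMDiff.contMDiffAt
  have h2 : ContMDiffAt 𝓘(ℝ, EuclideanSpace ℝ (Fin n) × EuclideanSpace ℝ (Fin n)) (𝓡 n) ω
      (fun p => (extChartAt (𝓡 n) (1 : G)).symm p.2) (e, e) :=
    ContMDiffAt.comp (e, e) hs contDiff_snd.contMDiff.contMDiffAt
  refine ContMDiffAt.comp (e, e) ?_ (h1.mul h2)
  simp only [e, extChartAt_to_inv, mul_one]
  exact contMDiffAt_extChartAt

theorem HasTangentAtOne.mul {γ δ : ℝ → G} {X Y : GroupLieAlgebra (𝓡 n) G}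
    (hγ : HasTangentAtOne γ X) (hδ : HasTangentAtOne δ Y) :
    HasTangentAtOne (fun τ => γ τ * δ τ) (X + Y) := by
  have : IsTopologicalGroup G := topologicalGroup_of_lieGroup (𝓡 n) ω
  rw [hasTangentAtOne_iff] at *
  obtain ⟨h0, hc, hd⟩ := hγ
  obtain ⟨h0', hc', hd'⟩ := hδ
  refine ⟨by simp [h0, h0'], hc.mul hc', ?_⟩
  have hm : DifferentiableAt ℝ (chartMul n G) _ := contDiffAt_chartMul.differentiableAt (by simp)
  have h1 := HasFDerivAt.comp_hasDerivAt_of_eq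
    (f := fun τ => (extChartAt (𝓡 n) (1 : G) (γ τ), extChartAt (𝓡 n) (1 : G) (δ τ)))
    (0 : ℝ) hm.hasFDerivAt (hd.prodMk hd') (by rw [h0, h0'])
  refine (h1.congr_deriv (fderiv_chartMul hm X Y)).congr_of_eventuallyEq ?_
  have hs := extChartAt_source_mem_nhds (I := 𝓡 n) (1 : G)
  filter_upwards [hc.eventually_mem (by rwa [h0]), hc'.eventually_mem (by rwa [h0'])] with τ h3 h4
  exact (chartMul_extChartAt h3 h4).symm

omit [LieGroup (𝓡 n) ω G] in
theorem HasTangentAtOne.comp_mul_left {γ : ℝ → G} {X : GroupLieAlgebra (𝓡 n) G}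
    (hγ : HasTangentAtOne γ X) (a : ℝ) : HasTangentAtOne (fun τ => γ (a * τ)) (a • X) := by
  rw [hasTangentAtOne_iff] at *
  obtain ⟨h0, hc, hd⟩ := hγ
  refine ⟨by simp [h0], ContinuousAt.comp_of_eq hc (by fun_prop) (by simp), ?_⟩
  exact HasDerivAt.scomp_of_eq (h := fun τ => a * τ) (h' := a) (0 : ℝ) hd
    (by simpa using (hasDerivAt_id (0 : ℝ)).const_mul a) (by simp)

omit [LieGroup (𝓡 n) ω G] in
theorem hasTangentAtOne_one : HasTangentAtOne (fun _ => (1 : G)) (0 : GroupLieAlgebra (𝓡 n) G) := by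
  rw [hasTangentAtOne_iff]
  exact ⟨rfl, continuousAt_const, hasDerivAt_const _ _⟩

theorem HasTangentAtOne.exists_conj {γ : ℝ → G} {X : GroupLieAlgebra (𝓡 n) G}
    (hγ : HasTangentAtOne γ X) (g : G) :
    ∃ Y : GroupLieAlgebra (𝓡 n) G, HasTangentAtOne (fun τ => g * γ τ * g⁻¹) Y := by
  refine exists_hasTangentAtOne (by simp [(hasTangentAtOne_iff.1 hγ).1]) ?_
  have h : ContMDiff (𝓡 n) (𝓡 n) ω (fun x : G => g * x * g⁻¹) :=
    (contMDiff_const.mul contMDiff_id).mul contMDiff_const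
  exact (h.mdifferentiable (by simp) _).comp (0 : ℝ) hγ.1

/-! ### Invariant vector fields and the Lie bracket in the chart -/

/-- Near the origin of the chart at the identity, an invariant vector field is the derivative of
`chartMul` in its second argument. -/
theorem mpullbackWithin_mulInvariantVectorField (v : GroupLieAlgebra (𝓡 n) G) :
    ∀ᶠ x in 𝓝 (extChartAt (𝓡 n) (1 : G) 1),
      (VectorField.mpullbackWithin 𝓘(ℝ, EuclideanSpace ℝ (Fin n)) (𝓡 n)
        (extChartAt (𝓡 n) (1 : G)).symm (mulInvariantVectorField v) (Set.range (𝓡 n)) x :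
          EuclideanSpace ℝ (Fin n)) =
      fderiv ℝ (chartMul n G) (x, extChartAt (𝓡 n) (1 : G) 1) (0, v) := by
  set e := extChartAt (𝓡 n) (1 : G) 1 with he
  have hd : ∀ᶠ p in 𝓝 (e, e), DifferentiableAt ℝ (chartMul n G) p :=
    ((contDiffAt_chartMul (n := n) (G := G)).eventually (by simp)).mono
      fun p hp => hp.differentiableAt (by simp)
  have hd' : ∀ᶠ x in 𝓝 e, DifferentiableAt ℝ (chartMul n G) (x, e) :=
    (Continuous.tendsto (f := fun x => (x, e)) (by fun_prop) e).eventually hd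
  filter_upwards [hd', extChartAt_target_mem_nhds (I := 𝓡 n) (1 : G)] with x hx hxt
  rw [VectorField.mpullbackWithin_apply]
  have hinv := isInvertible_mfderivWithin_extChartAt_symm (I := 𝓡 n) hxt
  refine (hinv.inverse_apply_eq).2 ?_
  set g := (extChartAt (𝓡 n) (1 : G)).symm x with hg
  have hgs : g ∈ (extChartAt (𝓡 n) (1 : G)).source := PartialEquiv.map_target _ hxt
  have hsymm : HasMFDerivAt 𝓘(ℝ, EuclideanSpace ℝ (Fin n)) (𝓡 n)
      (extChartAt (𝓡 n) (1 : G)).symm e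
      (ContinuousLinearMap.id ℝ (EuclideanSpace ℝ (Fin n))) := by
    have h := (mdifferentiableWithinAt_extChartAt_symm (I := 𝓡 n)
      (mem_extChartAt_target (I := 𝓡 n) (1 : G))).hasMFDerivWithinAt
    rw [mfderivWithin_range_extChartAt_symm] at h
    simp only [modelWithCornersSelf_coe, Set.range_id] at h
    exact hasMFDerivWithinAt_univ.1 h
  have hmul : HasMFDerivAt (𝓡 n) (𝓡 n) (g * ·) ((extChartAt (𝓡 n) (1 : G)).symm e)
      (mfderiv (𝓡 n) (𝓡 n) (g * ·) (1 : G)) := by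
    rw [he, extChartAt_to_inv]
    exact ((contMDiff_mul_left (I := 𝓡 n) (n := ω) (a := g)).mdifferentiable
      (by simp) (1 : G)).hasMFDerivAt
  have hφ : HasMFDerivAt (𝓡 n) 𝓘(ℝ, EuclideanSpace ℝ (Fin n)) (extChartAt (𝓡 n) (1 : G))
      (g * (extChartAt (𝓡 n) (1 : G)).symm e)
      (mfderiv (𝓡 n) 𝓘(ℝ, EuclideanSpace ℝ (Fin n)) (extChartAt (𝓡 n) (1 : G)) g) := by
    rw [he, extChartAt_to_inv, mul_one]
    exact (mdifferentiableAt_extChartAt (by simpa using hgs)).hasMFDerivAt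
  let D : EuclideanSpace ℝ (Fin n) →L[ℝ] EuclideanSpace ℝ (Fin n) :=
    mfderiv (𝓡 n) 𝓘(ℝ, EuclideanSpace ℝ (Fin n)) (extChartAt (𝓡 n) (1 : G)) g
  let L : EuclideanSpace ℝ (Fin n) →L[ℝ] EuclideanSpace ℝ (Fin n) :=
    mfderiv (𝓡 n) (𝓡 n) (g * ·) (1 : G)
  -- `chartMul n G (x, ·)` is the chart after left translation by `g` after the inverse chart, whose
  -- derivative at `e` is the identity.
  have hcomp : HasFDerivAt (fun y => chartMul n G (x, y)) (D.comp L) e :=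
    hasMFDerivAt_iff_hasFDerivAt.1 (HasMFDerivAt.comp e hφ (HasMFDerivAt.comp e hmul hsymm))
  have hchart := hcomp.unique
    (HasFDerivAt.comp (f := fun y => (x, y)) e hx.hasFDerivAt (hasFDerivAt_prodMk_right x e))
  have hv := congrArg (fun f : EuclideanSpace ℝ (Fin n) →L[ℝ] EuclideanSpace ℝ (Fin n) =>
    mfderivWithin 𝓘(ℝ, EuclideanSpace ℝ (Fin n)) (𝓡 n)
      (extChartAt (𝓡 n) (1 : G)).symm (Set.range (𝓡 n)) x (f v)) hchart
  refine Eq.trans ?_ hv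
  have := mfderivWithin_extChartAt_symm_comp_mfderiv_extChartAt (I := 𝓡 n) hxt
  exact (congrArg (fun f => f (mulInvariantVectorField v g)) this).symm

theorem bracket_eq_lieBracket_chartMul (v w : GroupLieAlgebra (𝓡 n) G) :
    (⁅v, w⁆ : GroupLieAlgebra (𝓡 n) G) = VectorField.lieBracket ℝ
      (fun x => fderiv ℝ (chartMul n G) (x, extChartAt (𝓡 n) (1 : G) 1) (0, v))
      (fun x => fderiv ℝ (chartMul n G) (x, extChartAt (𝓡 n) (1 : G) 1) (0, w))
      (extChartAt (𝓡 n) (1 : G) 1) := by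
  rw [GroupLieAlgebra.bracket_def, ← VectorField.mlieBracketWithin_univ,
    VectorField.mlieBracketWithin_apply, mfderiv_extChartAt_self]
  simp only [modelWithCornersSelf_coe, Set.range_id, Set.preimage_univ, Set.univ_inter]
  have h := Filter.EventuallyEq.lieBracket_vectorField_eq (𝕜 := ℝ)
    (mpullbackWithin_mulInvariantVectorField v) (mpullbackWithin_mulInvariantVectorField w)
  simp only [modelWithCornersSelf_coe, Set.range_id] at h
  refine Eq.trans ?_ h
  refine (DFunLike.congr_fun
    (ContinuousLinearMap.inverse_id (R := ℝ) (M := EuclideanSpace ℝ (Fin n))) _).trans ?_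
  exact congrFun VectorField.lieBracketWithin_univ _
end

/-- By the Jacobi identity the elements whose bracket maps `V` into itself form a subalgebra `K`;
then `V ⊓ K` is a subalgebra containing `s`. -/
theorem LieSubalgebra.lieSpan_le_of_lie_mem {R L : Type*} [CommRing R] [LieRing L] [LieAlgebra R L]
    {s : Set L} {V : Submodule R L} (hs : s ⊆ V) (h : ∀ x ∈ s, ∀ y ∈ V, ⁅x, y⁆ ∈ V) {y : L}
    (hy : y ∈ LieSubalgebra.lieSpan R L s) : y ∈ V := by
  let K : LieSubalgebra R L :=
    { carrier := {z | ∀ y ∈ V, ⁅z, y⁆ ∈ V}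
      add_mem' := fun ha hb y hy => by rw [add_lie]; exact V.add_mem (ha y hy) (hb y hy)
      zero_mem' := fun y _ => by simp
      smul_mem' := fun c z hz y hy => by rw [smul_lie]; exact V.smul_mem c (hz y hy)
      lie_mem' := fun ha hb y hy => by
        rw [lie_lie]; exact V.sub_mem (ha _ (hb y hy)) (hb _ (ha y hy)) }
  let W : LieSubalgebra R L :=
    { V ⊓ K.toSubmodule with
      lie_mem' := fun ha hb => ⟨ha.2 _ hb.1, K.lie_mem ha.2 hb.2⟩ }
  have hW : LieSubalgebra.lieSpan R L s ≤ W :=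
    LieSubalgebra.lieSpan_le.2 fun x hx => ⟨hs hx, h x hx⟩
  exact (hW hy).1

/-! ### The subspace of realizable tangents and its stability under brackets -/

section
variable {n M : ℕ} {G : Type*} [Group G]

theorem mul_mem_finiteProducts {σ : Fin M → ℝ → G} {g h : G} (hg : g ∈ finiteProducts σ)
    (hh : h ∈ finiteProducts σ) : g * h ∈ finiteProducts σ := by
  obtain ⟨l, hl, rfl⟩ := hg
  obtain ⟨l', hl', rfl⟩ := hh
  refine ⟨l ++ l', fun p hp => (List.mem_append.1 hp).elim (hl p) (hl' p), by simp⟩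

theorem one_mem_finiteProducts (σ : Fin M → ℝ → G) : (1 : G) ∈ finiteProducts σ :=
  ⟨[], by simp, by simp⟩

theorem mem_finiteProducts (σ : Fin M → ℝ → G) (i : Fin M) {s : ℝ} (hs : s ∈ Set.Icc (-1 : ℝ) 1) :
    σ i s ∈ finiteProducts σ :=
  ⟨[(i, s)], by simpa using hs, by simp⟩

theorem conjugateProductPath_append {R R' : ℕ} (σ : Fin M → ℝ → G) (j : Fin R → Fin M)
    (j' : Fin R' → Fin M) (α : Fin R → ℝ) (α' : Fin R' → ℝ) (g : Fin R → G) (g' : Fin R' → G)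
    (τ : ℝ) : conjugateProductPath σ (Fin.append j j') (Fin.append α α') (Fin.append g g') τ =
      conjugateProductPath σ j α g τ * conjugateProductPath σ j' α' g' τ := by
  rw [conjugateProductPath, conjugateProductPath, conjugateProductPath, ← List.prod_append,
    ← List.ofFn_fin_append]
  congr 2
  ext k
  refine Fin.addCases (fun k => ?_) (fun k => ?_) k <;> simp

theorem conjugateProductPath_conj {R : ℕ} (σ : Fin M → ℝ → G) (j : Fin R → Fin M)
    (α : Fin R → ℝ) (g : Fin R → G) (h : G) (τ : ℝ) :
    conjugateProductPath σ j α (fun k => h * g k) τ =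
      h * conjugateProductPath σ j α g τ * h⁻¹ := by
  rw [conjugateProductPath, conjugateProductPath, ← MulAut.conj_apply, map_list_prod,
    List.map_ofFn]
  congr 2
  ext k
  simp [mul_assoc]

theorem conjugateProductPath_comp_mul {R : ℕ} (σ : Fin M → ℝ → G) (j : Fin R → Fin M)
    (α : Fin R → ℝ) (g : Fin R → G) (a τ : ℝ) :
    conjugateProductPath σ j (fun k => α k * a) g τ = conjugateProductPath σ j α g (a * τ) := by
  simp [conjugateProductPath, mul_assoc]

variable [TopologicalSpace G] [ChartedSpace (EuclideanSpace ℝ (Fin n)) G]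

/-- `Y` is the identity tangent of a product of conjugates of rescaled basic paths. -/
def IsRealizable (σ : Fin M → ℝ → G) (Y : GroupLieAlgebra (𝓡 n) G) : Prop :=
  ∃ (R : ℕ) (j : Fin R → Fin M) (α : Fin R → ℝ) (g : Fin R → G),
    (∀ k, α k ∈ Set.Icc (-1 : ℝ) 1) ∧ (∀ k, g k ∈ finiteProducts σ) ∧
      HasTangentAtOne (conjugateProductPath σ j α g) Y

variable [LieGroup (𝓡 n) ω G] {σ : Fin M → ℝ → G} {Y Z : GroupLieAlgebra (𝓡 n) G}

theorem IsRealizable.add (hY : IsRealizable σ Y) (hZ : IsRealizable σ Z) :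
    IsRealizable σ (Y + Z) := by
  obtain ⟨R, j, α, g, hα, hg, h⟩ := hY
  obtain ⟨R', j', α', g', hα', hg', h'⟩ := hZ
  refine ⟨R + R', Fin.append j j', Fin.append α α', Fin.append g g', fun k => ?_, fun k => ?_, ?_⟩
  · exact Fin.addCases (fun k => by simpa using hα k) (fun k => by simpa using hα' k) k
  · exact Fin.addCases (fun k => by simpa using hg k) (fun k => by simpa using hg' k) k
  · rw [funext (conjugateProductPath_append σ j j' α α' g g')]
    exact h.mul h'

omit [LieGroup (𝓡 n) ω G] in
theorem isRealizable_zero : IsRealizable σ (0 : GroupLieAlgebra (𝓡 n) G) :=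
  ⟨0, Fin.elim0, Fin.elim0, Fin.elim0, fun k => k.elim0, fun k => k.elim0, by
    simpa [funext_iff, conjugateProductPath] using! hasTangentAtOne_one (n := n) (G := G)⟩

omit [LieGroup (𝓡 n) ω G] in
theorem IsRealizable.smul_of_abs_le_one (hY : IsRealizable σ Y) {a : ℝ} (ha : |a| ≤ 1) :
    IsRealizable σ (a • Y) := by
  obtain ⟨R, j, α, g, hα, hg, h⟩ := hY
  refine ⟨R, j, fun k => α k * a, g, fun k => ?_, hg, ?_⟩
  · rw [Set.mem_Icc, ← abs_le, abs_mul]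
    exact mul_le_one₀ (abs_le.2 (hα k)) (abs_nonneg a) ha
  · rw [funext (conjugateProductPath_comp_mul σ j α g a)]
    exact h.comp_mul_left a

theorem IsRealizable.nsmul (hY : IsRealizable σ Y) (N : ℕ) : IsRealizable σ (N • Y) := by
  induction N with
  | zero => simpa using isRealizable_zero
  | succ N ih => rw [succ_nsmul]; exact ih.add hY

theorem IsRealizable.smul (hY : IsRealizable σ Y) (a : ℝ) : IsRealizable σ (a • Y) := by
  obtain ⟨N, hN⟩ := exists_nat_gt |a|
  have hN0 : (0 : ℝ) < N := (abs_nonneg a).trans_lt hN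
  -- The parameters must stay in `[-1, 1]`, so a large scalar is split into `N` equal parts of size
  -- at most `1`, and the path for one part is repeated `N` times.
  have h := (hY.smul_of_abs_le_one (a := a / N) (by
    rw [abs_div, Nat.abs_cast]; exact (div_le_one hN0).2 hN.le)).nsmul N
  rwa [← Nat.cast_smul_eq_nsmul ℝ, smul_smul, mul_div_cancel₀ _ hN0.ne'] at h

/-- The realizable tangents form a submodule. -/
def realizableSubmodule (n : ℕ) [ChartedSpace (EuclideanSpace ℝ (Fin n)) G] [LieGroup (𝓡 n) ω G]
    (σ : Fin M → ℝ → G) : Submodule ℝ (GroupLieAlgebra (𝓡 n) G) where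
  carrier := {Y | IsRealizable σ Y}
  add_mem' := IsRealizable.add
  zero_mem' := isRealizable_zero
  smul_mem' a _ hY := hY.smul a

theorem IsRealizable.exists_conj (hY : IsRealizable σ Y) {h : G} (hh : h ∈ finiteProducts σ) :
    ∃ (γ : ℝ → G) (Z : GroupLieAlgebra (𝓡 n) G), IsRealizable σ Z ∧ HasTangentAtOne γ Y ∧
      HasTangentAtOne (fun τ => h * γ τ * h⁻¹) Z := by
  obtain ⟨R, j, α, g, hα, hg, hγ⟩ := hY
  obtain ⟨Z, hZ⟩ := hγ.exists_conj h
  refine ⟨_, Z, ⟨R, j, α, fun k => h * g k, hα, fun k => mul_mem_finiteProducts hh (hg k), ?_⟩,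
    hγ, hZ⟩
  rwa [funext (conjugateProductPath_conj σ j α g h)]

omit [LieGroup (𝓡 n) ω G] in
theorem isRealizable_of_hasTangentAtOne {i : Fin M} (h : HasTangentAtOne (σ i) Y) :
    IsRealizable σ Y := by
  refine ⟨1, fun _ => i, fun _ => 1, fun _ => 1, fun _ => by simp,
    fun _ => one_mem_finiteProducts σ, ?_⟩
  have : conjugateProductPath σ (fun _ : Fin 1 => i) (fun _ => 1) (fun _ => 1) = σ i := by
    ext τ; simp [conjugateProductPath]
  rwa [this]

theorem IsRealizable.lie {i : Fin M} {X : GroupLieAlgebra (𝓡 n) G} (hX : HasTangentAtOne (σ i) X)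
    (hY : IsRealizable σ Y) : IsRealizable σ ⁅X, Y⁆ := by
  have hm := contDiffAt_chartMul (n := n) (G := G)
  have hd := hm.differentiableAt (by simp)
  obtain ⟨h0, hc, hder⟩ := hasTangentAtOne_iff.1 hX
  set e := extChartAt (𝓡 n) (1 : G) 1 with he
  have hev : ∀ᶠ p in 𝓝 (e, e), DifferentiableAt ℝ (chartMul n G) p :=
    (hm.eventually (by simp)).mono fun p hp => hp.differentiableAt (by simp)
  have hcont := hder.continuousAt
  have h1 : ∀ᶠ s in 𝓝 (0 : ℝ), DifferentiableAt ℝ (chartMul n G)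
      (e, extChartAt (𝓡 n) (1 : G) (σ i s)) :=
    (continuousAt_const.prodMk hcont).eventually (by beta_reduce; rwa [h0, ← he])
  have h2 : ∀ᶠ s in 𝓝 (0 : ℝ), DifferentiableAt ℝ (chartMul n G)
      (extChartAt (𝓡 n) (1 : G) (σ i s), e) :=
    (hcont.prodMk continuousAt_const).eventually (by beta_reduce; rwa [h0, ← he])
  have h3 : ∀ᶠ s in 𝓝 (0 : ℝ), σ i s ∈ (extChartAt (𝓡 n) (1 : G)).source :=
    hc.eventually_mem (by rw [h0]; exact extChartAt_source_mem_nhds (I := 𝓡 n) (1 : G))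
  have h4 : ∀ᶠ s in 𝓝 (0 : ℝ), s ∈ Set.Icc (-1 : ℝ) 1 := Icc_mem_nhds (by norm_num) (by norm_num)
  change ⁅X, Y⁆ ∈ realizableSubmodule n σ
  rw [bracket_eq_lieBracket_chartMul]
  refine lieBracket_fderiv_mem (hm.of_le le_top) (fderiv_chartMul_left hd)
    (fderiv_chartMul_right hd) (realizableSubmodule n σ) hder (by rw [h0]) hY ?_
  filter_upwards [h1, h2, h3, h4] with s h1 h2 h3 h4
  -- `Z` plays the role of `Ad (σ i s) Y`; it is realizable since `σ i s` is itself a finite product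
  -- for `|s| ≤ 1`.
  obtain ⟨γ, Z, hZ, hγ, hγ'⟩ := hY.exists_conj (mem_finiteProducts σ i h4)
  exact ⟨Z, hZ, fderiv_chartMul_conj hγ hγ' h3 h1 h2⟩

end

theorem theorem1 {n : ℕ} {G : Type*} [TopologicalSpace G]
    [ChartedSpace (EuclideanSpace ℝ (Fin n)) G] [Group G] [LieGroup (𝓡 n) ω G]
    [ConnectedSpace G] {M : ℕ}
    (σ : Fin M → ℝ → G) (X : Fin M → GroupLieAlgebra (𝓡 n) G)
    (hσ : ∀ i, ContMDiffOn 𝓘(ℝ, ℝ) (𝓡 n) ω (σ i) (Set.Icc (-1) 1))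
    (hσ_one : ∀ i, σ i 0 = 1)
    (hσ_inv : ∀ i, ∀ τ ∈ Set.Icc (-1 : ℝ) 1, σ i (-τ) = (σ i τ)⁻¹)
    (hX : ∀ i, HasTangentAtOne (σ i) (X i))
    (Y : GroupLieAlgebra (𝓡 n) G)
    (hY : Y ∈ LieSubalgebra.lieSpan ℝ (GroupLieAlgebra (𝓡 n) G) (Set.range X)) :
    ∃ (R : ℕ) (j : Fin R → Fin M) (α : Fin R → ℝ) (g : Fin R → G),
      (∀ k, α k ∈ Set.Icc (-1 : ℝ) 1) ∧
      (∀ k, g k ∈ finiteProducts σ) ∧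
      HasTangentAtOne (conjugateProductPath σ j α g) Y := by
  refine LieSubalgebra.lieSpan_le_of_lie_mem (V := realizableSubmodule n σ) ?_ ?_ hY
  · rintro _ ⟨i, rfl⟩
    exact isRealizable_of_hasTangentAtOne (hX i)
  · rintro _ ⟨i, rfl⟩ Z hZ
    exact IsRealizable.lie (hX i) hZ
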